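/- Let $\mathcal H$ be a finite-dimensional complex Hilbert space and let $\mathfrak B_0(\mathcal H)$ be the set of density matrices on $\mathcal H$ (positive semidefinite, trace one). For $\rho_A,\rho_B\in\mathfrak B_0(\mathcal H)$ let $$F(\rho_A,\rho_B)=\operatorname{Tr}\sqrt{\sqrt{\rho_A}\,\rho_B\sqrt{\rho_A}}$$ be the fidelity. A preparation of $\rho$ is a Borel probability measure $P$ on $\mathfrak B_0(\mathcal H)$ with $\int\sigma\,dP(\sigma)=\rho$; let $\mathcal P(\rho)$ be the set of preparations of $\rho$. For $0<\alpha<1$ define $$C(\rho_A,\rho_B)=\sup_{P_A\in\mathcal P(\rho_A),\,P_B\in\mathcal P(\rho_B)}\int\sqrt{p_A\,p_B}\;d\mu,\qquad E_\alpha(\rho_A,\rho_B)=\sup_{P_A\in\mathcal P(\rho_A),\,P_B\in\mathcal P(\rho_B)}\int p_A^{\alpha}\,p_B^{1-\alpha}\,d\mu,$$ where $p_A,p_B$ are the densities of $P_A,P_B$ with respect to the dominating measure $\mu=P_A+P_B$. For integers $k\ge1$ define $$D_k(\rho_A,\rho_B)=\operatorname{Tr}\sqrt{\bigl[\rho_A^{1/2k}\,\rho_B^{1/k}\,\rho_A^{1/2k}\bigr]^{k}},\qquad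 D(\rho_A,\rho_B)=\lim_{k\to\infty}D_k(\rho_A,\rho_B).$$ Then for all $\rho_A,\rho_B\in\mathfrak B_0(\mathcal H)$: 1. If $F(\rho_A,\rho_B)=0$ then $C(\rho_A,\rho_B)=0$. Moreover $$F(\rho_A,\rho_B)=1\iff C(\rho_A,\rho_B)=1\iff\rho_A=\rho_B.$$ 2. The same holds with $D$ in place of $C$, where "$D(\rho_A,\rho_B)=c$" means that $D_k(\rho_A,\rho_B)$ converges to $c$ as $k\to\infty$. 3. For every $\alpha\in(0,1)$ the same holds with $E_\alpha$ in place of $C$. -/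

import Mathlib

open MeasureTheory Filter Topology
open scoped ComplexOrder

noncomputable section

namespace QuantumCompat

/-- Density matrices on the Hilbert space `ℂⁿ`: positive semidefinite matrices of trace one. -/
abbrev DensityMatrix (n : Type*) [Fintype n] : Type _ :=
  {ρ : Matrix n n ℂ // ρ.PosSemidef ∧ ρ.trace = 1}

instance {n : Type*} [Fintype n] : MeasurableSpace (DensityMatrix n) := borel _

instance {n : Type*} [Fintype n] : BorelSpace (DensityMatrix n) := ⟨rfl⟩

/-- The real power `M ^ s` of a positive semidefinite matrix, by functional calculus
(zero eigenvalues stay zero when `s > 0`). -/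
def matPow {n : Type*} [Fintype n] [DecidableEq n] (M : Matrix n n ℂ) (s : ℝ) : Matrix n n ℂ :=
  cfc (fun x : ℝ => x ^ s) M

/-- The square root of a positive semidefinite matrix. -/
def matSqrt {n : Type*} [Fintype n] [DecidableEq n] (M : Matrix n n ℂ) : Matrix n n ℂ :=
  cfc Real.sqrt M

/-- The fidelity `Tr √(√ρ_A ρ_B √ρ_A)`. -/
def fidelity {n : Type*} [Fintype n] [DecidableEq n] (ρA ρB : DensityMatrix n) : ℝ :=
  (matSqrt (matSqrt ρA.1 * ρB.1 * matSqrt ρA.1)).trace.re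

/-- The preparations of `ρ`: probability measures on the set of density matrices whose mean
is `ρ` (the mean is taken entrywise; entries of density matrices are bounded by one). -/
def preparations {n : Type*} [Fintype n] (ρ : DensityMatrix n) : Set (Measure (DensityMatrix n)) :=
  {P | IsProbabilityMeasure P ∧ ∀ i j, ∫ σ, σ.1 i j ∂P = ρ.1 i j}

/-- The classical fidelity `∫ √(P Q)` of two probability measures, in terms of their densities
with respect to the dominating measure `P + Q`. -/
def classicalFidelity {X : Type*} [MeasurableSpace X] (P Q : Measure X) : ℝ :=
  ∫ x, Real.sqrt ((P.rnDeriv (P + Q) x).toReal * (Q.rnDeriv (P + Q) x).toReal) ∂(P + Q)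

/-- The Rényi overlap `∫ P ^ α Q ^ (1 - α)` of two probability measures, in terms of their
densities with respect to the dominating measure `P + Q`. -/
def renyiOverlap {X : Type*} [MeasurableSpace X] (α : ℝ) (P Q : Measure X) : ℝ :=
  ∫ x, (P.rnDeriv (P + Q) x).toReal ^ α * (Q.rnDeriv (P + Q) x).toReal ^ (1 - α) ∂(P + Q)

/-- The compatibility `C(ρ_A, ρ_B)`: the largest classical fidelity of a preparation of `ρ_A`
and a preparation of `ρ_B`. -/
def compatibility {n : Type*} [Fintype n] (ρA ρB : DensityMatrix n) : ℝ :=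
  sSup {x : ℝ | ∃ P ∈ preparations ρA, ∃ Q ∈ preparations ρB, x = classicalFidelity P Q}

/-- The generalized compatibility `E_α(ρ_A, ρ_B)`: the largest Rényi overlap of a preparation of
`ρ_A` and a preparation of `ρ_B`. -/
def compatibilityE {n : Type*} [Fintype n] (α : ℝ) (ρA ρB : DensityMatrix n) : ℝ :=
  sSup {x : ℝ | ∃ P ∈ preparations ρA, ∃ Q ∈ preparations ρB, x = renyiOverlap α P Q}

/-- The quantities `D_k(ρ_A, ρ_B) = Tr √[(ρ_A ^ (1/2k) ρ_B ^ (1/k) ρ_A ^ (1/2k)) ^ k]`, `k ≥ 1`,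
equal to the fidelity for `k = 1`. The measure `D(ρ_A, ρ_B)` is their limit as `k → ∞`. -/
def compatibilityD {n : Type*} [Fintype n] [DecidableEq n] (k : ℕ) (ρA ρB : DensityMatrix n) : ℝ :=
  (matSqrt ((matPow ρA.1 (1 / (2 * (k : ℝ))) * matPow ρB.1 (1 / (k : ℝ)) *
    matPow ρA.1 (1 / (2 * (k : ℝ)))) ^ k)).trace.re

end QuantumCompat

end

/-! Only the two extreme values of the fidelity matter: value 0 forces `ρB * ρA = 0`, and value 1
forces `ρA = ρB` (equality case of Cauchy–Schwarz, after a polar decomposition). `C` is `E_α` at `α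
= 1/2`. If `ρB * ρA = 0`, an effect `M` kills `ρA` while `1 - M` kills `ρB`; so in any preparations
`Tr Mσ` vanishes `P`-a.e. and `Tr (1 - M)σ` vanishes `Q`-a.e., and as they sum to 1 the densities
have disjoint supports. If `ρA ≠ ρB`, some entry separates the means, so all preparations are a
fixed total variation apart and `renyiOverlap_le_of_integral_ne` keeps the supremum below 1. For
`D`, orthogonality passes to powers. If the limit is 1, `re_trace_pow_le` along `k = 2 ^ (i + 1)`
gives `1 ≤ Tr √ρA √ρB`, which forces the two roots to coincide. -/

namespace QuantumCompat

open Matrix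

/-! ### Traces and functional calculus of positive semidefinite matrices -/

section

variable {n : Type*} [Fintype n]

/-- The trace of a positive semidefinite matrix vanishes only if the matrix does, stated for the
real part of the trace. -/
theorem eq_zero_of_re_trace_nonpos {A : Matrix n n ℂ} (hA : A.PosSemidef)
    (h : A.trace.re ≤ 0) : A = 0 := by
  have h0 := Complex.nonneg_iff.1 hA.trace_nonneg
  exact hA.trace_eq_zero_iff.1 (Complex.ext (le_antisymm h h0.1) h0.2.symm)

theorem re_trace_nonneg {A : Matrix n n ℂ} (hA : A.PosSemidef) : 0 ≤ A.trace.re :=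
  (Complex.nonneg_iff.1 hA.trace_nonneg).1

theorem re_trace_conjTranspose (A : Matrix n n ℂ) : Aᴴ.trace.re = A.trace.re := by
  rw [trace_conjTranspose]; simp

/-- Hilbert–Schmidt Cauchy–Schwarz in additive form: expand `‖U - V‖² ≥ 0`. -/
theorem re_trace_mul_le (U V : Matrix n n ℂ) :
    2 * (U * Vᴴ).trace.re ≤ (U * Uᴴ).trace.re + (V * Vᴴ).trace.re := by
  have h := re_trace_nonneg (posSemidef_self_mul_conjTranspose (U - V))
  have hexp : (U - V) * (U - V)ᴴ = U * Uᴴ - U * Vᴴ - V * Uᴴ + V * Vᴴ := by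
    rw [conjTranspose_sub]; noncomm_ring
  have h2 : (V * Uᴴ).trace.re = (U * Vᴴ).trace.re := by
    rw [← re_trace_conjTranspose, conjTranspose_mul, conjTranspose_conjTranspose]
  rw [hexp, trace_add, trace_sub, trace_sub, Complex.add_re, Complex.sub_re, Complex.sub_re,
    h2] at h
  linarith

variable [DecidableEq n]

/-- The spectrum is finite, so every function is continuous on it. -/
theorem cfc_mul_cfc (f g : ℝ → ℝ) (A : Matrix n n ℂ) :
    cfc f A * cfc g A = cfc (fun x => f x * g x) A :=
  (cfc_mul f g A (A.finite_real_spectrum.continuousOn f) (A.finite_real_spectrum.continuousOn g)).symm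

theorem isHermitian_cfc (f : ℝ → ℝ) (A : Matrix n n ℂ) : (cfc f A).IsHermitian :=
  cfc_predicate f A

theorem nonneg_of_mem_spectrum {A : Matrix n n ℂ} (hA : A.PosSemidef) {x : ℝ}
    (hx : x ∈ spectrum ℝ A) : 0 ≤ x := by
  rw [hA.1.spectrum_real_eq_range_eigenvalues] at hx
  obtain ⟨i, rfl⟩ := hx
  exact hA.eigenvalues_nonneg i

theorem posSemidef_cfc {f : ℝ → ℝ} {A : Matrix n n ℂ} (hA : A.PosSemidef)
    (hf : ∀ x, 0 ≤ x → 0 ≤ f x) : (cfc f A).PosSemidef := by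
  have h : cfc f A = (cfc (fun x => √(f x)) A)ᴴ * cfc (fun x => √(f x)) A := by
    rw [(isHermitian_cfc _ A).eq, cfc_mul_cfc]
    exact cfc_congr fun x hx => (Real.mul_self_sqrt (hf x (nonneg_of_mem_spectrum hA hx))).symm
  rw [h]
  exact posSemidef_conjTranspose_mul_self _

theorem cfc_eq_self_of_nonneg {f : ℝ → ℝ} {A : Matrix n n ℂ} (hA : A.PosSemidef)
    (hf : ∀ x, 0 ≤ x → f x = x) : cfc f A = A := by
  conv_rhs => rw [← cfc_id ℝ A hA.1.isSelfAdjoint]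
  exact cfc_congr fun x hx => hf x (nonneg_of_mem_spectrum hA hx)

theorem posSemidef_matSqrt {A : Matrix n n ℂ} (hA : A.PosSemidef) : (matSqrt A).PosSemidef :=
  posSemidef_cfc hA fun x _ => Real.sqrt_nonneg x

theorem posSemidef_matPow {A : Matrix n n ℂ} (hA : A.PosSemidef) (s : ℝ) :
    (matPow A s).PosSemidef :=
  posSemidef_cfc hA fun _ hx => Real.rpow_nonneg hx s

theorem matSqrt_mul_matSqrt {A : Matrix n n ℂ} (hA : A.PosSemidef) :
    matSqrt A * matSqrt A = A := by
  rw [matSqrt, cfc_mul_cfc]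
  exact cfc_eq_self_of_nonneg hA fun x hx => Real.mul_self_sqrt hx

theorem matSqrt_sq {A : Matrix n n ℂ} (hA : A.PosSemidef) : matSqrt (A ^ 2) = A := by
  rw [matSqrt, ← cfc_comp_pow Real.sqrt 2 A Real.continuous_sqrt.continuousOn hA.1.isSelfAdjoint]
  exact cfc_eq_self_of_nonneg hA fun x hx => Real.sqrt_sq hx

theorem matSqrt_zero : matSqrt (0 : Matrix n n ℂ) = 0 := by
  simpa using matSqrt_sq (PosSemidef.zero (n := n) (R := ℂ))

/-- Since `0 ^ 0 = 1`, the law can fail on the kernel when `s + t = 0`. Negative exponents are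
otherwise allowed. -/
theorem matPow_mul_matPow {A : Matrix n n ℂ} (hA : A.PosSemidef) {s t : ℝ} (hst : s + t ≠ 0) :
    matPow A s * matPow A t = matPow A (s + t) := by
  rw [matPow, matPow, matPow, cfc_mul_cfc]
  exact cfc_congr fun x hx => (Real.rpow_add' (nonneg_of_mem_spectrum hA hx) hst).symm

theorem matPow_pow {A : Matrix n n ℂ} (hA : A.PosSemidef) (s : ℝ) (k : ℕ) :
    matPow A s ^ k = matPow A (s * k) := by
  rw [matPow, matPow, ← cfc_pow _ k A (A.finite_real_spectrum.continuousOn _) hA.1.isSelfAdjoint]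
  exact cfc_congr fun x hx => (Real.rpow_mul_natCast (nonneg_of_mem_spectrum hA hx) s k).symm

theorem matPow_one {A : Matrix n n ℂ} (hA : A.PosSemidef) : matPow A 1 = A :=
  cfc_eq_self_of_nonneg hA fun x _ => Real.rpow_one x

theorem matPow_half (A : Matrix n n ℂ) : matPow A (1 / 2) = matSqrt A := by
  rw [matPow, matSqrt]
  exact congrArg (cfc · A) (funext fun x => (Real.sqrt_eq_rpow x).symm)

/-! ### The fidelity -/

theorem mul_eq_zero_of_fidelity_eq_zero {ρA ρB : DensityMatrix n} (h : fidelity ρA ρB = 0) :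
    ρB.1 * ρA.1 = 0 := by
  have hA := (isHermitian_cfc Real.sqrt ρA.1).eq
  have hB := (isHermitian_cfc Real.sqrt ρB.1).eq
  have hAA := matSqrt_mul_matSqrt ρA.2.1
  have hBB := matSqrt_mul_matSqrt ρB.2.1
  rw [← matSqrt] at hA hB
  have hX : (matSqrt ρA.1 * ρB.1 * matSqrt ρA.1).PosSemidef := by
    simpa only [hA] using ρB.2.1.conjTranspose_mul_mul_same (matSqrt ρA.1)
  have hS := eq_zero_of_re_trace_nonpos (posSemidef_matSqrt hX) h.le
  have hX0 := matSqrt_mul_matSqrt hX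
  rw [hS, zero_mul] at hX0
  -- The vanishing matrix under the root is `Yᴴ * Y` for `Y = √ρB * √ρA`.
  have h0 : matSqrt ρB.1 * matSqrt ρA.1 = 0 := by
    rw [← conjTranspose_mul_self_eq_zero, conjTranspose_mul, hA, hB, hX0, ← mul_assoc,
      mul_assoc _ _ (matSqrt ρB.1), hBB]
  rw [← hBB, ← hAA, mul_assoc, ← mul_assoc _ _ (matSqrt ρA.1), h0]
  simp

theorem fidelity_self (ρ : DensityMatrix n) : fidelity ρ ρ = 1 := by
  have h : matSqrt ρ.1 * ρ.1 * matSqrt ρ.1 = ρ.1 ^ 2 := by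
    have hAA := matSqrt_mul_matSqrt ρ.2.1
    calc matSqrt ρ.1 * ρ.1 * matSqrt ρ.1
        = (matSqrt ρ.1 * matSqrt ρ.1) * (matSqrt ρ.1 * matSqrt ρ.1) := by
          nth_rewrite 2 [← hAA]; simp only [mul_assoc]
      _ = ρ.1 ^ 2 := by rw [hAA, sq]
  rw [fidelity, h, matSqrt_sq ρ.2.1, ρ.2.2, Complex.one_re]

/-- If `B` and `A` are Hermitian, then `B * A = U * S` for the positive semidefinite root `S` of
`A * B * B * A` and a partial isometry `U`; here only what is needed about `U` is recorded. -/
theorem exists_partialIsometry {A B : Matrix n n ℂ} (hA : A.IsHermitian) (hB : B.IsHermitian) :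
    ∃ U : Matrix n n ℂ, (1 - U * Uᴴ).PosSemidef ∧
      (Uᴴ * B * A).trace = (matSqrt (A * (B * B) * A)).trace := by
  have hX : (A * (B * B) * A).PosSemidef := by
    have := posSemidef_conjTranspose_mul_self (B * A)
    simpa only [conjTranspose_mul, hA.eq, hB.eq, mul_assoc] using this
  have hSpos := posSemidef_matSqrt hX
  have hSS := matSqrt_mul_matSqrt hX
  set S := matSqrt (A * (B * B) * A)
  -- `T` is the pseudo-inverse of `S`, because `0⁻¹ = 0`; the partial isometry is `B * A * T`.
  set T := cfc (fun x : ℝ => x⁻¹) S with hT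
  have hTH : Tᴴ = T := (isHermitian_cfc _ S).eq
  have hS : cfc (fun x : ℝ => x) S = S := cfc_eq_self_of_nonneg hSpos fun _ _ => rfl
  have hTSS : T * (S * S) = S := by
    have h : T * (cfc (fun x : ℝ => x) S * cfc (fun x : ℝ => x) S) = S := by
      rw [hT, cfc_mul_cfc, cfc_mul_cfc]
      exact cfc_eq_self_of_nonneg hSpos fun x _ => by
        by_cases h : x = 0 <;> simp [h]
    rwa [hS] at h
  have hTST : T * S * T = T := by
    have h : T * cfc (fun x : ℝ => x) S * T = T := by
      rw [hT, cfc_mul_cfc, cfc_mul_cfc]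
      exact cfc_congr fun x _ => by
        by_cases h : x = 0 <;> simp [h]
    rwa [hS] at h
  have hUH : (B * A * T)ᴴ = T * A * B := by
    rw [conjTranspose_mul, conjTranspose_mul, hTH, hA.eq, hB.eq, mul_assoc]
  have hUU : (T * A * B) * (B * A * T) = S * T := by
    calc (T * A * B) * (B * A * T) = T * (A * (B * B) * A) * T := by simp only [mul_assoc]
      _ = S * T := by rw [← hSS, hTSS]
  refine ⟨B * A * T, ?_, ?_⟩
  · rw [hUH]
    set W := (B * A * T) * (T * A * B) with hW
    have hWW : W * W = W := by
      calc W * W = B * A * T * ((T * A * B) * (B * A * T)) * (T * A * B) := by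
            simp only [hW, mul_assoc]
        _ = B * A * (T * S * T) * (T * A * B) := by rw [hUU]; simp only [mul_assoc]
        _ = W := by rw [hTST]
    have hWH : Wᴴ = W := by
      rw [hW, conjTranspose_mul, hUH, ← hUH, conjTranspose_conjTranspose]
    -- `W` is an orthogonal projection, so `1 - W` is its own Gram matrix.
    have := posSemidef_conjTranspose_mul_self (1 - W)
    rw [conjTranspose_sub, conjTranspose_one, hWH] at this
    have h2 : (1 - W) * (1 - W) = 1 - W := by
      rw [mul_sub, sub_mul, sub_mul, hWW]; simp
    rwa [h2] at this
  · rw [hUH]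
    calc (T * A * B * B * A).trace = (T * (A * (B * B) * A)).trace := by simp only [mul_assoc]
      _ = S.trace := by rw [← hSS, hTSS]

/-- With `A`, `B` the roots and `U` the partial isometry, `‖A - B * U‖² = 1 - 2 + Tr (B * U * Uᴴ *
B) ≤ 0`, so `A = B * U`. Then `ρA = B * U * Uᴴ * B ≤ B * B = ρB`, and equal traces give equality. -/
theorem eq_of_fidelity_eq_one {ρA ρB : DensityMatrix n} (h : fidelity ρA ρB = 1) : ρA = ρB := by
  have hA := isHermitian_cfc Real.sqrt ρA.1
  have hB := isHermitian_cfc Real.sqrt ρB.1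
  have hAA := matSqrt_mul_matSqrt ρA.2.1
  have hBB := matSqrt_mul_matSqrt ρB.2.1
  rw [fidelity, ← hBB] at h
  rw [← matSqrt] at hA hB
  obtain ⟨U, hU, htr⟩ := exists_partialIsometry hA hB
  set A := matSqrt ρA.1
  set B := matSqrt ρB.1
  have hAt : (A * A).trace.re = 1 := by rw [hAA, ρA.2.2]; rfl
  have hBt : (B * B).trace.re = 1 := by rw [hBB, ρB.2.2]; rfl
  have hD : (B * (1 - U * Uᴴ) * B).PosSemidef := by
    simpa only [hB.eq] using hU.conjTranspose_mul_mul_same B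
  have hDe : B * (1 - U * Uᴴ) * B = B * B - B * U * Uᴴ * B := by
    rw [mul_sub, sub_mul]; simp only [mul_one, mul_assoc]
  have hDt := re_trace_nonneg hD
  rw [hDe, trace_sub, Complex.sub_re, hBt] at hDt
  have h1 : (A * Uᴴ * B).trace.re = 1 := by
    rw [← h, ← htr, mul_assoc, trace_mul_comm]
  have h2 : (B * U * A).trace.re = 1 := by
    rw [← re_trace_conjTranspose, conjTranspose_mul, conjTranspose_mul, hA.eq, hB.eq, ← mul_assoc,
      h1]
  have hZ : A - B * U = 0 := by
    have hexp : (A - B * U) * (A - B * U)ᴴ = A * A - A * Uᴴ * B - B * U * A + B * U * Uᴴ * B := by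
      rw [conjTranspose_sub, conjTranspose_mul, hA.eq, hB.eq]; noncomm_ring
    have := eq_zero_of_re_trace_nonpos (posSemidef_self_mul_conjTranspose (A - B * U)) (by
      rw [hexp, trace_add, trace_sub, trace_sub, Complex.add_re, Complex.sub_re, Complex.sub_re,
        hAt, h1, h2]
      linarith)
    exact self_mul_conjTranspose_eq_zero.1 this
  have hAB : A * A = B * U * Uᴴ * B := by
    have h3 : A = B * U := sub_eq_zero.1 hZ
    nth_rewrite 2 [← hA.eq]
    rw [h3, conjTranspose_mul, hB.eq]; simp only [mul_assoc]
  have h0 : B * B - B * U * Uᴴ * B = 0 := by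
    rw [← hDe]
    refine eq_zero_of_re_trace_nonpos hD ?_
    rw [hDe, trace_sub, ← hAB, Complex.sub_re, hAt, hBt, sub_self]
  apply Subtype.ext
  rw [← hAA, ← hBB, hAB, sub_eq_zero.1 h0]

/-! ### The trace inequality `Tr (PQ)^m ≤ Tr P^m Q^m` for powers of two -/

theorem trace_mul_pow_comm (M N : Matrix n n ℂ) (k : ℕ) :
    ((M * N) ^ k).trace = ((N * M) ^ k).trace := by
  cases k with
  | zero => simp
  | succ k =>
    rw [pow_succ, ← mul_assoc, mul_pow_mul, trace_mul_comm, ← mul_assoc, ← pow_succ']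

/-- The two bounds feed each other. The first at `i + 1` comes from the first at `i` for `M ^ 2`,
the second at `i` for `M * Mᴴ` and `Mᴴ * M`, and Cauchy–Schwarz; the second at `i + 1` from the
first at `i` for `P * Q` and the second at `i` for `P ^ 2`, `Q ^ 2`. -/
theorem re_trace_pow_le (i : ℕ) :
    (∀ M : Matrix n n ℂ, (M ^ 2 ^ (i + 1)).trace.re ≤ ((M * Mᴴ) ^ 2 ^ i).trace.re) ∧
    (∀ P Q : Matrix n n ℂ, P.IsHermitian → Q.IsHermitian →
      ((P * Q) ^ 2 ^ i).trace.re ≤ (P ^ 2 ^ i * Q ^ 2 ^ i).trace.re) := by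
  induction i with
  | zero =>
    refine ⟨fun M => ?_, fun P Q _ _ => by simp⟩
    have h := re_trace_mul_le M Mᴴ
    rw [conjTranspose_conjTranspose, trace_mul_comm Mᴴ M] at h
    simp only [zero_add, pow_one, pow_zero, sq]
    linarith
  | succ i ih =>
    obtain ⟨hW, hG⟩ := ih
    refine ⟨fun M => ?_, fun P Q hP hQ => ?_⟩
    · have hL : (M * Mᴴ).IsHermitian := isHermitian_mul_conjTranspose_self M
      have hR : (Mᴴ * M).IsHermitian := isHermitian_conjTranspose_mul_self M
      have h1 := hW (M ^ 2)
      have h2 : ((M ^ 2 * (M ^ 2)ᴴ) ^ 2 ^ i).trace = ((M * Mᴴ * (Mᴴ * M)) ^ 2 ^ i).trace := by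
        rw [sq, conjTranspose_mul, mul_assoc M M, trace_mul_pow_comm]
        simp only [mul_assoc]
      have h3 := hG _ _ hL hR
      have h4 := re_trace_mul_le ((M * Mᴴ) ^ 2 ^ i) ((Mᴴ * M) ^ 2 ^ i)
      rw [(hL.pow _).eq, (hR.pow _).eq, ← pow_add, ← pow_add, ← two_mul, ← pow_succ',
        trace_mul_pow_comm Mᴴ M] at h4
      rw [← pow_mul, ← pow_succ', h2] at h1
      linarith
    · have h1 := hW (P * Q)
      have h2 : ((P * Q * (P * Q)ᴴ) ^ 2 ^ i).trace = ((P ^ 2 * Q ^ 2) ^ 2 ^ i).trace := by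
        rw [conjTranspose_mul, hP.eq, hQ.eq, mul_assoc P Q, trace_mul_pow_comm,
          ← trace_mul_pow_comm (Q ^ 2)]
        simp only [mul_assoc, sq]
      have h3 := hG _ _ (hP.pow 2) (hQ.pow 2)
      rw [← pow_mul, ← pow_mul, ← pow_succ'] at h3
      rw [h2] at h1
      exact h1.trans h3

/-! ### The quantities `D_k` -/

theorem compatibilityD_eq_zero {ρA ρB : DensityMatrix n} (h : ρB.1 * ρA.1 = 0) {k : ℕ}
    (hk : k ≠ 0) : compatibilityD k ρA ρB = 0 := by
  have hk' : (0 : ℝ) < k := by positivity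
  -- Splitting off a full factor exposes `ρB * ρA` inside the product; `s - 1` may be negative.
  have hpow : ∀ {A : Matrix n n ℂ}, A.PosSemidef → ∀ {s : ℝ}, s ≠ 0 →
      matPow A s = matPow A (s - 1) * A ∧ matPow A s = A * matPow A (s - 1) := by
    intro A hA s hs
    constructor
    · nth_rewrite 3 [← matPow_one hA]
      rw [matPow_mul_matPow hA (by simpa using hs)]; simp
    · nth_rewrite 2 [← matPow_one hA]
      rw [matPow_mul_matPow hA (by simpa using hs)]; simp
  rw [compatibilityD, (hpow ρB.2.1 (by positivity : 1 / (k : ℝ) ≠ 0)).1,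
    mul_assoc (matPow ρA.1 _), mul_assoc _ ρB.1]
  nth_rewrite 2 [(hpow ρA.2.1 (by positivity : 1 / (2 * (k : ℝ)) ≠ 0)).2]
  rw [← mul_assoc ρB.1, h]
  simp [hk, matSqrt_zero]

theorem compatibilityD_self (ρ : DensityMatrix n) {k : ℕ} (hk : k ≠ 0) :
    compatibilityD k ρ ρ = 1 := by
  have hk' : (0 : ℝ) < k := by positivity
  rw [compatibilityD, matPow_mul_matPow ρ.2.1 (by positivity),
    matPow_mul_matPow ρ.2.1 (by positivity), matPow_pow ρ.2.1]
  have : (1 / (2 * (k : ℝ)) + 1 / k + 1 / (2 * k)) * k = 1 * (2 : ℕ) := by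
    field_simp; norm_num
  rw [this, ← matPow_pow ρ.2.1, matPow_one ρ.2.1, matSqrt_sq ρ.2.1, ρ.2.2, Complex.one_re]

/-- For even `k = 2 * m` the square root is just the `m`-th power, and cyclicity turns its trace
into `Tr (ρA ^ (1/k) * ρB ^ (1/k)) ^ m`. -/
theorem compatibilityD_two_pow_le (ρA ρB : DensityMatrix n) (i : ℕ) :
    compatibilityD (2 ^ (i + 1)) ρA ρB ≤ (matSqrt ρA.1 * matSqrt ρB.1).trace.re := by
  set m : ℕ := 2 ^ i with hm
  have hm' : (0 : ℝ) < m := by rw [hm]; positivity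
  have hcast : ((2 ^ (i + 1) : ℕ) : ℝ) = 2 * m := by rw [hm]; push_cast; ring
  rw [compatibilityD, hcast]
  set P := matPow ρA.1 (1 / (2 * (2 * (m : ℝ)))) with hP
  set Q := matPow ρB.1 (1 / (2 * (m : ℝ))) with hQ
  have hPH : P.IsHermitian := (posSemidef_matPow ρA.2.1 _).1
  have hZ : (P * Q * P).PosSemidef := by
    simpa only [hPH.eq] using (posSemidef_matPow ρB.2.1 _).conjTranspose_mul_mul_same P
  have h1 : (P * Q * P) ^ 2 ^ (i + 1) = ((P * Q * P) ^ m) ^ 2 := by rw [← pow_mul, hm, pow_succ]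
  have h2 : (matPow ρA.1 (1 / (2 * (m : ℝ)))) ^ m = matSqrt ρA.1 := by
    rw [matPow_pow ρA.2.1, ← matPow_half]; congr 1; field_simp
  have h3 : Q ^ m = matSqrt ρB.1 := by
    rw [hQ, matPow_pow ρB.2.1, ← matPow_half]; congr 1; field_simp
  have h4 : P * P = matPow ρA.1 (1 / (2 * (m : ℝ))) := by
    rw [hP, matPow_mul_matPow ρA.2.1 (by positivity)]; congr 1; field_simp; norm_num
  rw [h1, matSqrt_sq (hZ.pow m), mul_assoc, trace_mul_pow_comm, mul_assoc, h4,
    trace_mul_pow_comm, ← h2, ← h3]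
  exact (re_trace_pow_le i).2 _ _ (posSemidef_matPow ρA.2.1 _).1 (posSemidef_matPow ρB.2.1 _).1

theorem eq_of_tendsto_compatibilityD {ρA ρB : DensityMatrix n}
    (h : Tendsto (fun k : ℕ => compatibilityD k ρA ρB) atTop (𝓝 1)) : ρA = ρB := by
  have hsub : Tendsto (fun i : ℕ => 2 ^ (i + 1)) atTop atTop :=
    (tendsto_pow_atTop_atTop_of_one_lt (one_lt_two : 1 < 2)).comp (tendsto_add_atTop_nat 1)
  have h1 : 1 ≤ (matSqrt ρA.1 * matSqrt ρB.1).trace.re :=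
    le_of_tendsto' (h.comp hsub) (compatibilityD_two_pow_le ρA ρB)
  have hAH := (posSemidef_matSqrt ρA.2.1).1
  have hBH := (posSemidef_matSqrt ρB.2.1).1
  have hAA := matSqrt_mul_matSqrt ρA.2.1
  have hBB := matSqrt_mul_matSqrt ρB.2.1
  set A := matSqrt ρA.1
  set B := matSqrt ρB.1
  have hAt : (A * A).trace.re = 1 := by rw [hAA, ρA.2.2]; rfl
  have hBt : (B * B).trace.re = 1 := by rw [hBB, ρB.2.2]; rfl
  have hexp : (A - B) * (A - B)ᴴ = A * A - A * B - B * A + B * B := by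
    rw [conjTranspose_sub, hAH.eq, hBH.eq]; noncomm_ring
  -- The trace is `2 - 2 * Tr (A * B) ≤ 0`.
  have h0 := eq_zero_of_re_trace_nonpos (posSemidef_self_mul_conjTranspose (A - B)) (by
    rw [hexp, trace_add, trace_sub, trace_sub, Complex.add_re, Complex.sub_re, Complex.sub_re,
      hAt, hBt, trace_mul_comm B A]
    linarith)
  have hAB : A = B := sub_eq_zero.1 (self_mul_conjTranspose_eq_zero.1 h0)
  apply Subtype.ext
  rw [← hAA, ← hBB, hAB]

end

/-! ### Overlaps of probability measures -/

theorem rpow_mul_rpow_one_sub_le {α p q : ℝ} (h0 : 0 < α) (h1 : α < 1) (hp : 0 ≤ p)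
    (hq : 0 ≤ q) : p ^ α * q ^ (1 - α) ≤ α * p + (1 - α) * q :=
  Real.geom_mean_le_arith_mean2_weighted h0.le (by linarith) hp hq (by ring)

/-- The weighted geometric mean is a proper convex combination of the unweighted geometric mean
and one of the two arguments, up to an inequality. -/
theorem exists_rpow_mul_rpow_one_sub_le {α : ℝ} (h0 : 0 < α) (h1 : α < 1) :
    ∃ a b c : ℝ, 0 < a ∧ 0 ≤ b ∧ 0 ≤ c ∧ a + b + c = 1 ∧ ∀ p q : ℝ, 0 ≤ p → 0 ≤ q →
      p ^ α * q ^ (1 - α) ≤ a * √(p * q) + b * p + c * q := by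
  -- Weighted AM–GM for `p ^ β * q ^ (1 - β) = √(p * q) ^ (2 * β) * q ^ (1 - 2 * β)`.
  have key : ∀ β : ℝ, 0 < β → β ≤ 1 / 2 → ∀ p q : ℝ, 0 ≤ p → 0 ≤ q →
      p ^ β * q ^ (1 - β) ≤ 2 * β * √(p * q) + (1 - 2 * β) * q := by
    intro β hβ hβ2 p q hp hq
    have h := Real.geom_mean_le_arith_mean2_weighted (by linarith : 0 ≤ 2 * β)
      (by linarith : 0 ≤ 1 - 2 * β) (Real.sqrt_nonneg (p * q)) hq (by ring)
    refine le_of_eq_of_le ?_ h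
    rw [Real.sqrt_eq_rpow, ← Real.rpow_mul (mul_nonneg hp hq), Real.mul_rpow hp hq, mul_assoc,
      ← Real.rpow_add' hq (by linarith)]
    congr 2 <;> ring
  rcases le_total α (1 / 2) with h | h
  · exact ⟨2 * α, 0, 1 - 2 * α, by linarith, le_rfl, by linarith, by ring, fun p q hp hq =>
      (key α h0 h p q hp hq).trans_eq (by ring)⟩
  · refine ⟨2 * (1 - α), 1 - 2 * (1 - α), 0, by linarith, by linarith, le_rfl, by ring,
      fun p q hp hq => ?_⟩
    have := key (1 - α) (by linarith) (by linarith) q p hq hp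
    rw [sub_sub_cancel, mul_comm q p] at this
    linarith

/-- A linearised Hellinger versus total variation bound: with `p = x ^ 2`, `q = y ^ 2` it follows
from `(|x - y| - t * (x + y)) ^ 2 ≥ 0`. The free `t` is tuned after integration. -/
theorem sqrt_mul_le {p q : ℝ} (hp : 0 ≤ p) (hq : 0 ≤ q) (t : ℝ) :
    √(p * q) ≤ (1 / 2 + t ^ 2) * (p + q) - t * |p - q| := by
  obtain ⟨x, hx, rfl⟩ : ∃ x, 0 ≤ x ∧ p = x ^ 2 := ⟨√p, Real.sqrt_nonneg p, (Real.sq_sqrt hp).symm⟩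
  obtain ⟨y, hy, rfl⟩ : ∃ x, 0 ≤ x ∧ q = x ^ 2 := ⟨√q, Real.sqrt_nonneg q, (Real.sq_sqrt hq).symm⟩
  rw [← mul_pow, Real.sqrt_sq (mul_nonneg hx hy), sq_sub_sq, abs_mul,
    abs_of_nonneg (add_nonneg hx hy)]
  have h1 := sq_nonneg (|x - y| - t * (x + y))
  have h2 := sq_abs (x - y)
  have h3 := mul_nonneg (sq_nonneg t) (sq_nonneg (x - y))
  nlinarith

section

variable {X : Type*} [MeasurableSpace X] (P Q : Measure X)

theorem absolutelyContinuous_add_left : P ≪ P + Q :=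
  (Measure.le_add_right le_rfl).absolutelyContinuous

theorem absolutelyContinuous_add_right : Q ≪ P + Q :=
  (Measure.le_add_left le_rfl).absolutelyContinuous

theorem classicalFidelity_eq_renyiOverlap : classicalFidelity P Q = renyiOverlap (1 / 2) P Q := by
  refine integral_congr_ae (.of_forall fun x => ?_)
  simp only
  rw [Real.sqrt_eq_rpow, Real.mul_rpow ENNReal.toReal_nonneg ENNReal.toReal_nonneg]
  norm_num

variable [IsProbabilityMeasure P] [IsProbabilityMeasure Q]

theorem integral_rnDeriv_add_left : ∫ x, (P.rnDeriv (P + Q) x).toReal ∂(P + Q) = 1 := by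
  rw [Measure.integral_toReal_rnDeriv (absolutelyContinuous_add_left P Q)]; simp

theorem integral_rnDeriv_add_right : ∫ x, (Q.rnDeriv (P + Q) x).toReal ∂(P + Q) = 1 := by
  rw [Measure.integral_toReal_rnDeriv (absolutelyContinuous_add_right P Q)]; simp

theorem renyiOverlap_le_one {α : ℝ} (h0 : 0 < α) (h1 : α < 1) : renyiOverlap α P Q ≤ 1 := by
  have hp := (Measure.integrable_toReal_rnDeriv (μ := P) (ν := P + Q)).const_mul α
  have hq := (Measure.integrable_toReal_rnDeriv (μ := Q) (ν := P + Q)).const_mul (1 - α)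
  calc renyiOverlap α P Q
      ≤ ∫ x, (α * (P.rnDeriv (P + Q) x).toReal + (1 - α) * (Q.rnDeriv (P + Q) x).toReal)
          ∂(P + Q) :=
        integral_mono_of_nonneg (.of_forall fun x => by positivity) (hp.add hq)
          (.of_forall fun x => rpow_mul_rpow_one_sub_le h0 h1 ENNReal.toReal_nonneg
            ENNReal.toReal_nonneg)
    _ = 1 := by
        rw [integral_add hp hq, integral_const_mul, integral_const_mul,
          integral_rnDeriv_add_left, integral_rnDeriv_add_right]
        ring

theorem renyiOverlap_self {α : ℝ} : renyiOverlap α P P = 1 := by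
  have h : ∀ x : ℝ, 0 ≤ x → x ^ α * x ^ (1 - α) = x := fun x hx => by
    rw [← Real.rpow_add' hx (by norm_num)]; norm_num
  rw [renyiOverlap, integral_congr_ae (.of_forall fun x => h _ ENNReal.toReal_nonneg),
    integral_rnDeriv_add_left]

/-- The difference of the means of a bounded function is at most the total variation. -/
theorem norm_integral_sub_integral_le {f : X → ℂ} (hf : Measurable f) (hb : ∀ x, ‖f x‖ ≤ 1) :
    ‖∫ x, f x ∂P - ∫ x, f x ∂Q‖ ≤
      ∫ x, |(P.rnDeriv (P + Q) x).toReal - (Q.rnDeriv (P + Q) x).toReal| ∂(P + Q) := by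
  have hp := Measure.integrable_toReal_rnDeriv (μ := P) (ν := P + Q)
  have hq := Measure.integrable_toReal_rnDeriv (μ := Q) (ν := P + Q)
  have hpf : Integrable (fun x => (P.rnDeriv (P + Q) x).toReal • f x) (P + Q) :=
    hp.smul_bdd 1 hf.aestronglyMeasurable (.of_forall hb)
  have hqf : Integrable (fun x => (Q.rnDeriv (P + Q) x).toReal • f x) (P + Q) :=
    hq.smul_bdd 1 hf.aestronglyMeasurable (.of_forall hb)
  rw [← integral_rnDeriv_smul (absolutelyContinuous_add_left P Q),
    ← integral_rnDeriv_smul (absolutelyContinuous_add_right P Q), ← integral_sub hpf hqf]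
  refine (norm_integral_le_integral_norm _).trans
    (integral_mono_of_nonneg (.of_forall fun x => norm_nonneg _) (hp.sub hq).abs
      (.of_forall fun x => ?_))
  simp only
  rw [← sub_smul, norm_smul, Real.norm_eq_abs]
  exact mul_le_of_le_one_right (abs_nonneg _) (hb x)

/-- If a nonnegative function has mean zero for `P`, another one has mean zero for `Q`, and they
have no common zero, then the overlap vanishes. -/
theorem renyiOverlap_eq_zero {α : ℝ} (h0 : 0 < α) (h1 : α < 1) {f g : X → ℝ}
    (hf : Integrable f P) (hg : Integrable g Q) (hf0 : ∀ x, 0 ≤ f x) (hg0 : ∀ x, 0 ≤ g x)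
    (hfg : ∀ x, f x + g x ≠ 0) (hfi : ∫ x, f x ∂P = 0) (hgi : ∫ x, g x ∂Q = 0) :
    renyiOverlap α P Q = 0 := by
  have hPQ := absolutelyContinuous_add_left P Q
  have hQP := absolutelyContinuous_add_right P Q
  have h2 : ∀ᵐ x ∂(P + Q), (P.rnDeriv (P + Q) x).toReal * f x = 0 := by
    rw [← integral_toReal_rnDeriv_mul hPQ] at hfi
    exact (integral_eq_zero_iff_of_nonneg
      (fun x => mul_nonneg ENNReal.toReal_nonneg (hf0 x))
      ((integrable_rnDeriv_smul_iff hPQ).2 hf)).1 hfi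
  have h3 : ∀ᵐ x ∂(P + Q), (Q.rnDeriv (P + Q) x).toReal * g x = 0 := by
    rw [← integral_toReal_rnDeriv_mul hQP] at hgi
    exact (integral_eq_zero_iff_of_nonneg
      (fun x => mul_nonneg ENNReal.toReal_nonneg (hg0 x))
      ((integrable_rnDeriv_smul_iff hQP).2 hg)).1 hgi
  refine integral_eq_zero_of_ae ?_
  filter_upwards [h2, h3] with x hx hy
  rcases mul_eq_zero.1 hx with h | h
  · simp [h, Real.zero_rpow h0.ne']
  · rcases mul_eq_zero.1 hy with h' | h'
    · simp [h', Real.zero_rpow (sub_pos.2 h1).ne']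
    · exact absurd (by rw [h, h', add_zero]) (hfg x)

end

/-- Probability measures that are separated by a bounded function have an overlap that is bounded
away from one. -/
theorem renyiOverlap_le_of_integral_ne {α : ℝ} (h0 : 0 < α) (h1 : α < 1) {d : ℝ} (hd : 0 < d) :
    ∃ r < 1, ∀ {X : Type*} [MeasurableSpace X] (P Q : Measure X) [IsProbabilityMeasure P]
      [IsProbabilityMeasure Q] (f : X → ℂ), Measurable f → (∀ x, ‖f x‖ ≤ 1) →
      d ≤ ‖∫ x, f x ∂P - ∫ x, f x ∂Q‖ → renyiOverlap α P Q ≤ r := by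
  obtain ⟨a, b, c, ha, hb, hc, habc, hpt⟩ := exists_rpow_mul_rpow_one_sub_le h0 h1
  -- Integrating `sqrt_mul_le` gives `1 + 2 * t ^ 2 - t * d`, smallest at `t = d / 4`. The bound is
  -- fixed before the measures, so it survives the supremum.
  refine ⟨1 - a * d ^ 2 / 8, by linarith [show 0 < a * d ^ 2 by positivity], ?_⟩
  intro X _ P Q _ _ f hf hfb hle
  have hp := Measure.integrable_toReal_rnDeriv (μ := P) (ν := P + Q)
  have hq := Measure.integrable_toReal_rnDeriv (μ := Q) (ν := P + Q)
  have htv := hle.trans (norm_integral_sub_integral_le P Q hf hfb)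
  set p : X → ℝ := fun x => (P.rnDeriv (P + Q) x).toReal with hpd
  set q : X → ℝ := fun x => (Q.rnDeriv (P + Q) x).toReal with hqd
  have hp1 : ∫ x, p x ∂(P + Q) = 1 := integral_rnDeriv_add_left P Q
  have hq1 : ∫ x, q x ∂(P + Q) = 1 := integral_rnDeriv_add_right P Q
  have habs : Integrable (fun x => |p x - q x|) (P + Q) := (hp.sub hq).abs
  set A := a * (1 / 2 + (d / 4) ^ 2) with hA
  have i1 := hp.const_mul (A + b)
  have i2 := hq.const_mul (A + c)
  have i12 : Integrable (fun x => (A + b) * p x + (A + c) * q x) (P + Q) := i1.add i2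
  have i3 := habs.const_mul (a * (d / 4))
  calc renyiOverlap α P Q
      ≤ ∫ x, ((A + b) * p x + (A + c) * q x - a * (d / 4) * |p x - q x|) ∂(P + Q) := by
        refine integral_mono_of_nonneg (.of_forall fun x => by positivity) (i12.sub i3)
          (.of_forall fun x => ?_)
        have hx := hpt (p x) (q x) ENNReal.toReal_nonneg ENNReal.toReal_nonneg
        have hs := mul_le_mul_of_nonneg_left (sqrt_mul_le (p := p x) (q := q x)
          ENNReal.toReal_nonneg ENNReal.toReal_nonneg (d / 4)) ha.le
        simp only [hpd, hqd] at hx hs ⊢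
        refine hx.trans ?_
        rw [hA]
        linarith
    _ = (A + b) + (A + c) - a * (d / 4) * ∫ x, |p x - q x| ∂(P + Q) := by
        rw [integral_sub i12 i3, integral_add i1 i2, integral_const_mul,
          integral_const_mul, integral_const_mul, hp1, hq1]
        simp
    _ ≤ 1 - a * d ^ 2 / 8 := by
        have := mul_le_mul_of_nonneg_left htv (by positivity : 0 ≤ a * (d / 4))
        rw [hA]
        nlinarith

/-! ### Preparations of density matrices -/

section

variable {n : Type*} [Fintype n]

/-- The squared entries of the Hermitian root `S` sum to the trace, so its rows have norm at most 1.
This makes entries admissible test functions. -/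
theorem norm_entry_le_one (σ : DensityMatrix n) (i j : n) : ‖σ.1 i j‖ ≤ 1 := by
  classical
  have hH := (posSemidef_matSqrt σ.2.1).1
  have hSS := matSqrt_mul_matSqrt σ.2.1
  set S := matSqrt σ.1
  have hdiag : ∀ i, σ.1 i i = ∑ k, ((‖S i k‖ ^ 2 : ℝ) : ℂ) := fun i => by
    rw [← hSS, Matrix.mul_apply]
    refine Finset.sum_congr rfl fun k _ => ?_
    rw [← hH.apply k i, Complex.ofReal_pow]
    exact Complex.mul_conj' _
  have htr : ∑ i, ∑ k, ‖S i k‖ ^ 2 = 1 := by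
    have h := σ.2.2
    rw [Matrix.trace] at h
    simp only [Matrix.diag_apply, hdiag] at h
    exact_mod_cast h
  have hle : ∀ i, ∑ k, ‖S i k‖ ^ 2 ≤ 1 := fun i => by
    rw [← htr]
    exact Finset.single_le_sum (f := fun i => ∑ k, ‖S i k‖ ^ 2)
      (fun i _ => Finset.sum_nonneg fun k _ => sq_nonneg _) (Finset.mem_univ i)
  calc ‖σ.1 i j‖ = ‖∑ k, S i k * S k j‖ := by rw [← Matrix.mul_apply, hSS]
    _ ≤ ∑ k, (‖S i k‖ ^ 2 + ‖S j k‖ ^ 2) / 2 := by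
        refine norm_sum_le_of_le _ fun k _ => ?_
        rw [norm_mul, ← hH.apply k j, norm_star]
        linarith [two_mul_le_add_sq ‖S i k‖ ‖S j k‖]
    _ ≤ 1 := by
        rw [← Finset.sum_div, Finset.sum_add_distrib]
        linarith [hle i, hle j]

theorem continuous_entry (i j : n) : Continuous fun σ : DensityMatrix n => σ.1 i j :=
  continuous_subtype_val.matrix_elem i j

theorem integrable_entry (P : Measure (DensityMatrix n)) [IsFiniteMeasure P] (i j : n) :
    Integrable (fun σ : DensityMatrix n => σ.1 i j) P :=
  .of_bound (continuous_entry i j).measurable.aestronglyMeasurable 1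
    (.of_forall fun σ => norm_entry_le_one σ i j)

theorem integrable_trace_mul (P : Measure (DensityMatrix n)) [IsFiniteMeasure P]
    (M : Matrix n n ℂ) : Integrable (fun σ : DensityMatrix n => (M * σ.1).trace) P := by
  simp only [Matrix.trace, Matrix.diag_apply, Matrix.mul_apply]
  exact integrable_finsetSum _ fun i _ => integrable_finsetSum _ fun j _ =>
    (integrable_entry P j i).const_mul _

theorem integral_trace_mul {ρ : DensityMatrix n} {P : Measure (DensityMatrix n)}
    (hP : P ∈ preparations ρ) (M : Matrix n n ℂ) :
    ∫ σ, (M * σ.1).trace ∂P = (M * ρ.1).trace := by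
  have := hP.1
  have hi : ∀ i j, Integrable (fun σ : DensityMatrix n => M i j * σ.1 j i) P :=
    fun i j => (integrable_entry P j i).const_mul _
  simp only [Matrix.trace, Matrix.diag_apply, Matrix.mul_apply]
  rw [integral_finsetSum _ fun i _ => integrable_finsetSum _ fun j _ => hi i j]
  refine Finset.sum_congr rfl fun i _ => ?_
  rw [integral_finsetSum _ fun j _ => hi i j]
  exact Finset.sum_congr rfl fun j _ => by rw [integral_const_mul, hP.2]

theorem integral_re_trace_mul {ρ : DensityMatrix n} {P : Measure (DensityMatrix n)}
    (hP : P ∈ preparations ρ) {M : Matrix n n ℂ} (hM : M * ρ.1 = 0) :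
    ∫ σ, (M * σ.1).trace.re ∂P = 0 := by
  have := hP.1
  have h := integral_re (integrable_trace_mul P M)
  rw [integral_trace_mul hP, hM] at h
  simpa using h

theorem dirac_mem_preparations (ρ : DensityMatrix n) : Measure.dirac ρ ∈ preparations ρ :=
  ⟨inferInstance, fun i j => integral_dirac' _ _ (continuous_entry i j).measurable.stronglyMeasurable⟩

theorem compatibility_eq_compatibilityE (ρA ρB : DensityMatrix n) :
    compatibility ρA ρB = compatibilityE (1 / 2) ρA ρB := by
  simp only [compatibility, compatibilityE, classicalFidelity_eq_renyiOverlap]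

theorem compatibilityE_le {α r : ℝ} {ρA ρB : DensityMatrix n}
    (h : ∀ P ∈ preparations ρA, ∀ Q ∈ preparations ρB, renyiOverlap α P Q ≤ r) :
    compatibilityE α ρA ρB ≤ r := by
  refine csSup_le ⟨_, _, dirac_mem_preparations ρA, _, dirac_mem_preparations ρB, rfl⟩ ?_
  rintro _ ⟨P, hP, Q, hQ, rfl⟩
  exact h P hP Q hQ

theorem compatibilityE_self {α : ℝ} (h0 : 0 < α) (h1 : α < 1) (ρ : DensityMatrix n) :
    compatibilityE α ρ ρ = 1 := by
  have hle : ∀ P ∈ preparations ρ, ∀ Q ∈ preparations ρ, renyiOverlap α P Q ≤ 1 := by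
    intro P hP Q hQ
    have := hP.1
    have := hQ.1
    exact renyiOverlap_le_one P Q h0 h1
  refine le_antisymm (compatibilityE_le hle) (le_csSup ⟨1, ?_⟩ ?_)
  · rintro _ ⟨P, hP, Q, hQ, rfl⟩
    exact hle P hP Q hQ
  · exact ⟨_, dirac_mem_preparations ρ, _, dirac_mem_preparations ρ,
      (renyiOverlap_self (Measure.dirac ρ)).symm⟩

theorem eq_of_compatibilityE_eq_one {α : ℝ} (h0 : 0 < α) (h1 : α < 1) {ρA ρB : DensityMatrix n}
    (h : compatibilityE α ρA ρB = 1) : ρA = ρB := by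
  by_contra hne
  obtain ⟨i, j, hij⟩ : ∃ i j, ρA.1 i j ≠ ρB.1 i j := by
    by_contra! hall
    exact hne (Subtype.ext (Matrix.ext hall))
  -- The gap depends only on the means, so one `r` serves all preparations.
  obtain ⟨r, hr, hle⟩ := renyiOverlap_le_of_integral_ne h0 h1 (norm_pos_iff.2 (sub_ne_zero.2 hij))
  refine absurd (compatibilityE_le fun P hP Q hQ => ?_) (not_le.2 (hr.trans_eq h.symm))
  have := hP.1
  have := hQ.1
  exact hle P Q (fun σ => σ.1 i j) (continuous_entry i j).measurable
    (fun σ => norm_entry_le_one σ i j) (by rw [hP.2, hQ.2])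

theorem compatibilityE_eq_one_iff {α : ℝ} (h0 : 0 < α) (h1 : α < 1) {ρA ρB : DensityMatrix n} :
    compatibilityE α ρA ρB = 1 ↔ ρA = ρB :=
  ⟨eq_of_compatibilityE_eq_one h0 h1, by rintro rfl; exact compatibilityE_self h0 h1 _⟩

end

/-! ### Orthogonal density matrices and the equivalences -/

section

variable {n : Type*} [Fintype n] [DecidableEq n]

theorem re_trace_mul_nonneg {M N : Matrix n n ℂ} (hM : M.PosSemidef) (hN : N.PosSemidef) :
    0 ≤ (M * N).trace.re := by
  have h := re_trace_nonneg (hN.conjTranspose_mul_mul_same (matSqrt M))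
  rwa [(posSemidef_matSqrt hM).1.eq, Matrix.trace_mul_comm, ← mul_assoc,
    matSqrt_mul_matSqrt hM] at h

/-- Two density matrices with product zero are perfectly distinguished by a two-outcome
measurement. -/
theorem exists_effect {ρA ρB : DensityMatrix n} (h : ρB.1 * ρA.1 = 0) :
    ∃ M : Matrix n n ℂ, M.PosSemidef ∧ (1 - M).PosSemidef ∧ M * ρA.1 = 0 ∧ (1 - M) * ρB.1 = 0 := by
  have hAB : ρA.1 * ρB.1 = 0 := by
    have := congrArg Matrix.conjTranspose h
    rwa [Matrix.conjTranspose_mul, ρA.2.1.1.eq, ρB.2.1.1.eq, Matrix.conjTranspose_zero] at this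
  have hid : cfc (fun x : ℝ => x) ρA.1 = ρA.1 := cfc_id' ℝ ρA.1 ρA.2.1.1.isSelfAdjoint
  -- `M` projects onto the kernel of `ρA`; its complement has `ρA` as right factor, hence kills
  -- `ρB`.
  set M := cfc (fun x : ℝ => if x = 0 then 1 else 0) ρA.1 with hM
  have hM1 : 1 - M = cfc (fun x : ℝ => x⁻¹ * x) ρA.1 := by
    rw [sub_eq_iff_eq_add, hM, ← cfc_add ρA.1 _ _ (ρA.1.finite_real_spectrum.continuousOn _)
      (ρA.1.finite_real_spectrum.continuousOn _), ← cfc_one ℝ ρA.1 ρA.2.1.1.isSelfAdjoint]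
    refine cfc_congr fun x _ => ?_
    by_cases hx : x = 0 <;> simp [hx]
  refine ⟨M, posSemidef_cfc ρA.2.1 fun x _ => by positivity, ?_, ?_, ?_⟩
  · rw [hM1]
    exact posSemidef_cfc ρA.2.1 fun x hx => by positivity
  · rw [← cfc_zero ℝ ρA.1]
    have h0 : M * ρA.1 = M * cfc (fun x : ℝ => x) ρA.1 := by rw [hid]
    rw [h0, hM, cfc_mul_cfc]
    refine cfc_congr fun x _ => ?_
    by_cases hx : x = 0 <;> simp [hx]
  · rw [hM1, ← cfc_mul_cfc, hid, mul_assoc, hAB, mul_zero]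

theorem compatibilityE_eq_zero {α : ℝ} (h0 : 0 < α) (h1 : α < 1) {ρA ρB : DensityMatrix n}
    (h : ρB.1 * ρA.1 = 0) : compatibilityE α ρA ρB = 0 := by
  obtain ⟨M, hM, hM1, hMA, hMB⟩ := exists_effect h
  have hz : ∀ P ∈ preparations ρA, ∀ Q ∈ preparations ρB, renyiOverlap α P Q = 0 := by
    intro P hP Q hQ
    have := hP.1
    have := hQ.1
    refine renyiOverlap_eq_zero P Q h0 h1 (integrable_trace_mul P M).re
      (integrable_trace_mul Q (1 - M)).re (fun σ => re_trace_mul_nonneg hM σ.2.1)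
      (fun σ => re_trace_mul_nonneg hM1 σ.2.1) (fun σ => ?_) (integral_re_trace_mul hP hMA)
      (integral_re_trace_mul hQ hMB)
    rw [← map_add, ← Matrix.trace_add, ← add_mul, add_sub_cancel, one_mul, σ.2.2]
    simp
  refine le_antisymm (compatibilityE_le fun P hP Q hQ => (hz P hP Q hQ).le)
    (Real.sSup_nonneg ?_)
  rintro _ ⟨P, hP, Q, hQ, rfl⟩
  exact (hz P hP Q hQ).ge

theorem fidelity_eq_one_iff {ρA ρB : DensityMatrix n} : fidelity ρA ρB = 1 ↔ ρA = ρB :=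
  ⟨eq_of_fidelity_eq_one, by rintro rfl; exact fidelity_self _⟩

theorem tendsto_compatibilityD_one_iff {ρA ρB : DensityMatrix n} :
    Tendsto (fun k : ℕ => compatibilityD k ρA ρB) atTop (𝓝 1) ↔ ρA = ρB := by
  refine ⟨eq_of_tendsto_compatibilityD, ?_⟩
  rintro rfl
  -- At `k = 0` the formula returns the dimension, so that index is discarded.
  exact tendsto_const_nhds.congr' ((eventually_ne_atTop 0).mono fun k hk =>
    (compatibilityD_self ρA hk).symm)

end

end QuantumCompat

theorem mainTheorem6 {n : Type*} [Fintype n] [DecidableEq n]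
    (ρA ρB : QuantumCompat.DensityMatrix n) :
    -- the compatibility `C`
    ((QuantumCompat.fidelity ρA ρB = 0 → QuantumCompat.compatibility ρA ρB = 0) ∧
      (QuantumCompat.fidelity ρA ρB = 1 ↔ QuantumCompat.compatibility ρA ρB = 1) ∧
      (QuantumCompat.compatibility ρA ρB = 1 ↔ ρA = ρB)) ∧
    -- the measure `D`, the limit of the `D_k`
    ((QuantumCompat.fidelity ρA ρB = 0 →
        Tendsto (fun k : ℕ => QuantumCompat.compatibilityD k ρA ρB) atTop (𝓝 0)) ∧
      (QuantumCompat.fidelity ρA ρB = 1 ↔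
        Tendsto (fun k : ℕ => QuantumCompat.compatibilityD k ρA ρB) atTop (𝓝 1)) ∧
      (Tendsto (fun k : ℕ => QuantumCompat.compatibilityD k ρA ρB) atTop (𝓝 1) ↔ ρA = ρB)) ∧
    -- the measures `E_α`
    (∀ α : ℝ, 0 < α → α < 1 →
      (QuantumCompat.fidelity ρA ρB = 0 → QuantumCompat.compatibilityE α ρA ρB = 0) ∧
      (QuantumCompat.fidelity ρA ρB = 1 ↔ QuantumCompat.compatibilityE α ρA ρB = 1) ∧
      (QuantumCompat.compatibilityE α ρA ρB = 1 ↔ ρA = ρB)) := by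
  have hE : ∀ α : ℝ, 0 < α → α < 1 →
      (QuantumCompat.fidelity ρA ρB = 0 → QuantumCompat.compatibilityE α ρA ρB = 0) ∧
      (QuantumCompat.fidelity ρA ρB = 1 ↔ QuantumCompat.compatibilityE α ρA ρB = 1) ∧
      (QuantumCompat.compatibilityE α ρA ρB = 1 ↔ ρA = ρB) := fun α h0 h1 =>
    ⟨fun h => QuantumCompat.compatibilityE_eq_zero h0 h1
        (QuantumCompat.mul_eq_zero_of_fidelity_eq_zero h),
      QuantumCompat.fidelity_eq_one_iff.trans (QuantumCompat.compatibilityE_eq_one_iff h0 h1).symm,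
      QuantumCompat.compatibilityE_eq_one_iff h0 h1⟩
  refine ⟨?_, ⟨fun h => ?_, ?_, QuantumCompat.tendsto_compatibilityD_one_iff⟩, hE⟩
  · rw [QuantumCompat.compatibility_eq_compatibilityE]
    exact hE (1 / 2) (by norm_num) (by norm_num)
  · exact tendsto_const_nhds.congr' ((eventually_ne_atTop 0).mono fun k hk =>
      (QuantumCompat.compatibilityD_eq_zero
        (QuantumCompat.mul_eq_zero_of_fidelity_eq_zero h) hk).symm)
  · exact QuantumCompat.fidelity_eq_one_iff.trans QuantumCompat.tendsto_compatibilityD_one_iff.symm
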